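/- **Theorem 2 (Almost Sure Convergence).** Let $v$ be a random variable, let $f(\cdot;v):\mathbb R^n\to\mathbb R$ be such that $F(x)=\mathbf E[f(x;v)]$ is well defined (integrable) for every $x$, let $\mathcal X_1,\dots,\mathcal X_m\subset\mathbb R^n$ be closed and convex, and $\mathcal X=\bigcap_{i=1}^m\mathcal X_i$. Consider the problem of minimizing $F(x)$ over $x\in\mathcal X$. For a nonempty closed convex set $Y$ let $\Pi_Y$ be the Euclidean projection onto $Y$, and let $\mathrm d(x)=\|x-\Pi_{\mathcal X}x\|$. Suppose: 1. (a) $F$ is convex and continuous, $\mathcal X\neq\emptyset$, and the problem has at least one optimal solution. (b) A (jointly measurable) stochastic subgradient $g(x,v)\in\mathbb R^n$ satisfies $\mathbf E[g(x,v)]\in\partial F(x)$ for all $x\in\mathbb R^n$. (c) There is $B>0$ with $\mathbf E[\|g(x,v)\|^2]\le B^2$ for all $x\in\mathbb R^n$. (d) There is $D>0$ with $\|x-\bar x\|\le D$ for all $x,\bar x\in\mathcal X_i$ and all $i=1,\dots,m$. 2. (Linear regularity) There is $\eta\in(0,1)$ with $\eta\|x-\Pi_{\mathcal X}x\|^2\le\max_{i=1,\dots,m}\|x-\Pi_{\mathcal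 X_i}x\|^2$ for all $x\in\mathbb R^n$. Let $1\le M\le m$, $x_0\in\mathbb R^n$, and let $\alpha_k>0$ satisfy $\sum_{k=0}^\infty\alpha_k=\infty$ and $\sum_{k=0}^\infty\alpha_k^2<\infty$. For $k=0,1,2,\dots$ let $v_{k+1}$ be distributed as $v$, and let $\omega_{k+1}=(\omega_{k+1,1},\dots,\omega_{k+1,M})$ be drawn uniformly without replacement from $\{1,\dots,m\}$, all the random variables $v_1,\omega_1,v_2,\omega_2,\dots$ being independent. Let $$y_{k+1}=x_k-\alpha_k\,g(x_k,v_{k+1}),\qquad p_{k+1,i}=\Pi_{\mathcal X_{\omega_{k+1,i}}}y_{k+1}\quad(i=1,\dots,M),$$ and let $x_{k+1}$ be given, for all $k$, by one of the following three rules: - Algorithm 1 (averaging): $x_{k+1}=\frac1M\sum_{i=1}^M p_{k+1,i}$. - Algorithm 2 (max-set): $x_{k+1}=p_{k+1,i^*}$ with $i^*\in\operatorname{argmax}_{i=1,\dots,M}\|p_{k+1,i}-y_{k+1}\|$, where ties are broken in any way such that $x_{k+1}$ is a measurable function of the samples $v_t,\omega_t$, $t\le k+1$. - Algorithm 3 (polyhedral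 set): $x_{k+1}=\Pi_{\mathcal P_k}y_{k+1}$ with $\mathcal P_k=\{z\in\mathbb R^n: a_i^\top z\le b_i,\ i=1,\dots,M\}$, $a_i=y_{k+1}-p_{k+1,i}$, $b_i=a_i^\top p_{k+1,i}$. Then, for each of the three algorithms, $\{x_k\}$ converges almost surely to a random point in the set of optimal solutions of the problem, and $\{\mathrm d(x_k)\}$ converges almost surely to $0$. -/

import Mathlib

open MeasureTheory ProbabilityTheory Filter Topology

/-- `p` is a nearest point of `K` to `y` (a minimizer of `‖y - z‖` over `z ∈ K`). -/
def IsProjection {n : ℕ} (K : Set (EuclideanSpace ℝ (Fin n)))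
    (y p : EuclideanSpace ℝ (Fin n)) : Prop :=
  p ∈ K ∧ ∀ z ∈ K, ‖y - p‖ ≤ ‖y - z‖

open Classical in
/-- The Euclidean projection `Π_K y`; it is the unique nearest point whenever `K` is nonempty,
closed and convex, see `euclProj_spec`. (Junk value `y` if there is no nearest point.) -/
noncomputable def euclProj {n : ℕ} (K : Set (EuclideanSpace ℝ (Fin n)))
    (y : EuclideanSpace ℝ (Fin n)) : EuclideanSpace ℝ (Fin n) :=
  if h : ∃ p, IsProjection K y p then h.choose else y

/-- On nonempty closed convex sets, `euclProj` is the one and only nearest point. -/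
theorem euclProj_spec {n : ℕ} {K : Set (EuclideanSpace ℝ (Fin n))} (hne : K.Nonempty)
    (hcl : IsClosed K) (hcv : Convex ℝ K) (y p : EuclideanSpace ℝ (Fin n)) :
    IsProjection K y p ↔ p = euclProj K y := by
  have hiff : ∀ q, IsProjection K y q ↔ q ∈ K ∧ ∀ w ∈ K, inner ℝ (y - q) (w - q) ≤ 0 := by
    intro q
    refine and_congr_right fun hq => ?_
    rw [← norm_eq_iInf_iff_real_inner_le_zero hcv hq]
    have : Nonempty K := ⟨⟨q, hq⟩⟩
    have hb : BddBelow (Set.range fun w : K => ‖y - w‖) :=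
      ⟨0, by rintro _ ⟨w, rfl⟩; exact norm_nonneg _⟩
    constructor
    · intro h
      exact le_antisymm (le_ciInf fun w => h w w.2) (ciInf_le hb ⟨q, hq⟩)
    · intro h z hz
      rw [h]
      exact ciInf_le hb ⟨z, hz⟩
  have hex : ∃ q, IsProjection K y q := by
    obtain ⟨q, hq, hmin⟩ := hcl.exists_infDist_eq_dist hne y
    refine ⟨q, hq, fun z hz => ?_⟩
    rw [← dist_eq_norm, ← dist_eq_norm, ← hmin]
    exact Metric.infDist_le_dist_of_mem hz
  have huniq : ∀ q r, IsProjection K y q → IsProjection K y r → q = r := by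
    intro q r hq hr
    obtain ⟨hqK, hq⟩ := (hiff q).1 hq
    obtain ⟨hrK, hr⟩ := (hiff r).1 hr
    have h1 := hq r hrK
    have h2 := hr q hqK
    have h3 : inner ℝ (r - q) (r - q) ≤ 0 := by
      have e : inner ℝ (r - q) (r - q)
          = inner ℝ (y - q) (r - q) + inner ℝ (y - r) (q - r) := by
        simp only [inner_sub_left, inner_sub_right]
        ring
      linarith
    have h4 : r - q = 0 := by
      have := real_inner_self_nonneg (x := r - q)
      exact inner_self_eq_zero.1 (le_antisymm h3 this)
    exact (sub_eq_zero.1 h4).symm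
  have hp : IsProjection K y (euclProj K y) := by
    unfold euclProj
    rw [dif_pos hex]
    exact hex.choose_spec
  exact ⟨fun h => huniq _ _ h hp, fun h => h ▸ hp⟩

/-- The distance `d(x, K) = ‖x - Π_K x‖`. -/
noncomputable def projDist {n : ℕ} (K : Set (EuclideanSpace ℝ (Fin n)))
    (x : EuclideanSpace ℝ (Fin n)) : ℝ :=
  ‖x - euclProj K x‖

/-- The subdifferential `∂F(x)` of a function on `ℝⁿ`. -/
def subdifferential {n : ℕ} (F : EuclideanSpace ℝ (Fin n) → ℝ)
    (x : EuclideanSpace ℝ (Fin n)) : Set (EuclideanSpace ℝ (Fin n)) :=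
  {s | ∀ z, F x + inner ℝ s (z - x) ≤ F z}

/-- The feasible set `X = ⋂ i, X_i`. -/
def feasibleSet {n m : ℕ} (X : Fin m → Set (EuclideanSpace ℝ (Fin n))) :
    Set (EuclideanSpace ℝ (Fin n)) :=
  ⋂ i, X i

/-- The objective `F(x) = E[f(x; v)]`, where `v` has law `ν`. -/
noncomputable def expectedObjective {n : ℕ} {V : Type*} [MeasurableSpace V] (ν : Measure V)
    (f : EuclideanSpace ℝ (Fin n) → V → ℝ) (x : EuclideanSpace ℝ (Fin n)) : ℝ :=
  ∫ w, f x w ∂ν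

/-- The set of optimal solutions of: minimize `F` over `K`. -/
def optimalSet {n : ℕ} (F : EuclideanSpace ℝ (Fin n) → ℝ)
    (K : Set (EuclideanSpace ℝ (Fin n))) : Set (EuclideanSpace ℝ (Fin n)) :=
  {x | x ∈ K ∧ ∀ z ∈ K, F x ≤ F z}

/-- The basic assumptions on the problem `min F = E[f(·; v)]` over `⋂ i, X_i` and on the stochastic
subgradient `g(x, v)`, where `v` has law `ν`. -/
structure BasicAssumptions {n m : ℕ} {V : Type*} [MeasurableSpace V] (ν : Measure V)
    (f : EuclideanSpace ℝ (Fin n) → V → ℝ)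
    (g : EuclideanSpace ℝ (Fin n) → V → EuclideanSpace ℝ (Fin n))
    (X : Fin m → Set (EuclideanSpace ℝ (Fin n))) : Prop where
  /-- the expectation that defines `F` exists -/
  integrable_f : ∀ x, Integrable (f x) ν
  convex_F : ConvexOn ℝ Set.univ (expectedObjective ν f)
  continuous_F : Continuous (expectedObjective ν f)
  isClosed_X : ∀ i, IsClosed (X i)
  convex_X : ∀ i, Convex ℝ (X i)
  nonempty_feasible : (feasibleSet X).Nonempty
  exists_optimal : (optimalSet (expectedObjective ν f) (feasibleSet X)).Nonempty
  measurable_g : Measurable (Function.uncurry g)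
  /-- the sample subgradients are unbiased -/
  unbiased : ∀ x, (∫ w, g x w ∂ν) ∈ subdifferential (expectedObjective ν f) x
  /-- the sample subgradients have uniformly bounded second moments -/
  bounded_second_moment :
    ∃ B : ℝ, 0 < B ∧ ∀ x, MemLp (g x) 2 ν ∧ ∫ w, ‖g x w‖ ^ 2 ∂ν ≤ B ^ 2
  /-- the constraint sets are uniformly bounded -/
  bounded_X : ∃ D : ℝ, 0 < D ∧ ∀ i, ∀ x ∈ X i, ∀ z ∈ X i, ‖x - z‖ ≤ D

/-- The linear regularity condition. -/
def LinearRegularity {n m : ℕ} (X : Fin m → Set (EuclideanSpace ℝ (Fin n))) : Prop :=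
  ∃ η : ℝ, 0 < η ∧ η < 1 ∧
    ∀ x, η * ‖x - euclProj (feasibleSet X) x‖ ^ 2 ≤ ⨆ i, ‖x - euclProj (X i) x‖ ^ 2

/-- The random variables returned by the sampling oracle: in iteration `k` (`k = 0, 1, 2, …`) it
draws `v k` with law `ν` and the indices `s k 0, …, s k (M - 1)` of `M` constraint sets, uniformly
without replacement from `Fin m`, independently of `v k`. Different iterations are independent. -/
structure IsSamplingOracle {Ω V : Type*} [MeasurableSpace Ω] [MeasurableSpace V] {m M : ℕ}
    (P : Measure Ω) (ν : Measure V) (v : ℕ → Ω → V) (s : ℕ → Ω → Fin M → Fin m) : Prop where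
  measurable_v : ∀ k, Measurable (v k)
  measurable_s : ∀ k, Measurable (s k)
  law_v : ∀ k, P.map (v k) = ν
  law_s : ∀ k, P.map (s k) = uniformOn {σ : Fin M → Fin m | Function.Injective σ}
  indep_v_s : ∀ k, IndepFun (v k) (s k) P
  indep_calls : iIndepFun (fun k a => (v k a, s k a)) P

/-- The σ-algebra generated by the oracle's samples in iterations `0, …, k - 1`, i.e. by everything
that has been drawn when the iterate `x k` is formed. -/
@[reducible] def sampleHistory {Ω V : Type*} [MeasurableSpace V] {m M : ℕ}
    (v : ℕ → Ω → V) (s : ℕ → Ω → Fin M → Fin m) (k : ℕ) : MeasurableSpace Ω :=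
  ⨆ j : Fin k, MeasurableSpace.comap (fun a => (v j a, s j a)) inferInstance

/-- Stochastic subgradient step: `y = x - α g(x, w)`. -/
def gradientStep {n : ℕ} {V : Type*}
    (g : EuclideanSpace ℝ (Fin n) → V → EuclideanSpace ℝ (Fin n)) (α : ℝ)
    (x : EuclideanSpace ℝ (Fin n)) (w : V) : EuclideanSpace ℝ (Fin n) :=
  x - α • g x w

/-- Averaging step: `x'` is the average of the sampled projections `p i` of `y`. -/
def AveragingStep {n M : ℕ} (_y : EuclideanSpace ℝ (Fin n))
    (p : Fin M → EuclideanSpace ℝ (Fin n)) (x' : EuclideanSpace ℝ (Fin n)) : Prop :=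
  x' = (1 / (M : ℝ)) • ∑ i, p i

/-- Max-set step: `x'` is a most distant one among the sampled projections `p i` of `y`. -/
def MaxSetStep {n M : ℕ} (y : EuclideanSpace ℝ (Fin n))
    (p : Fin M → EuclideanSpace ℝ (Fin n)) (x' : EuclideanSpace ℝ (Fin n)) : Prop :=
  ∃ i, (∀ j, ‖p j - y‖ ≤ ‖p i - y‖) ∧ x' = p i

/-- The polyhedron `{z | a_i ⬝ z ≤ b_i for all i}` with `a_i = y - p i` and `b_i = a_i ⬝ p i`. -/
def samplePolyhedron {n M : ℕ} (y : EuclideanSpace ℝ (Fin n))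
    (p : Fin M → EuclideanSpace ℝ (Fin n)) : Set (EuclideanSpace ℝ (Fin n)) :=
  {z | ∀ i, inner ℝ (y - p i) z ≤ inner ℝ (y - p i) (p i)}

/-- Polyhedral-set step: `x'` is the projection of `y` on the sampled polyhedron. -/
def PolyhedralStep {n M : ℕ} (y : EuclideanSpace ℝ (Fin n))
    (p : Fin M → EuclideanSpace ℝ (Fin n)) (x' : EuclideanSpace ℝ (Fin n)) : Prop :=
  x' = euclProj (samplePolyhedron y p) y

/-- The process `x` is generated from `x₀` by stochastic subgradient steps
`y = x_k - α_k g(x_k, v_k)`, each followed by the feasibility update `step` applied to `y` and to its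
projections on the sampled sets. `adapted` says that `x k` is a random variable that depends on
the samples drawn so far only. (A restriction only where `step` leaves a choice, namely the choice
among several most distant points in `MaxSetStep`: it must not anticipate future samples.) -/
structure IsIterateSequence {Ω V : Type*} [MeasurableSpace V] {n m M : ℕ}
    (step : EuclideanSpace ℝ (Fin n) → (Fin M → EuclideanSpace ℝ (Fin n)) →
      EuclideanSpace ℝ (Fin n) → Prop)
    (g : EuclideanSpace ℝ (Fin n) → V → EuclideanSpace ℝ (Fin n))
    (X : Fin m → Set (EuclideanSpace ℝ (Fin n))) (α : ℕ → ℝ) (x₀ : EuclideanSpace ℝ (Fin n))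
    (v : ℕ → Ω → V) (s : ℕ → Ω → Fin M → Fin m)
    (x : ℕ → Ω → EuclideanSpace ℝ (Fin n)) : Prop where
  init : ∀ a, x 0 a = x₀
  update : ∀ k a,
    step (gradientStep g (α k) (x k a) (v k a))
      (fun i => euclProj (X (s k a i)) (gradientStep g (α k) (x k a) (v k a)))
      (x (k + 1) a)
  adapted : ∀ k, Measurable[sampleHistory v s k] (x k)

/-! All three updates satisfy one deterministic inequality for feasible `z`: the squared distance
from `x'` to `z` is at most that from `y`, minus the average of the squared distances from `y` to
its sampled projections (the three `norm_sub_sq_le` lemmas). Nothing else about the algorithms is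
used. Averaging over the sample, linear regularity turns the subtracted term into a multiple of the
squared distance to the feasible set, and the subgradient inequality yields `2 α (F x - F z)`. As `F
x` may lie below the optimal value when `x` is infeasible, `F` is evaluated at the projection of
`x`; the error is linear in the distance and is absorbed by Young's inequality. What remains is a
nonnegative decrease up to an `O(α²)` error (`BasicAssumptions.integral_stepBound_le`). The
Robbins–Siegmund argument then gives, for each optimal `z`, almost sure convergence of the distances
to `z` and summability of the decreases. Pathwise, since `∑ α = ∞`, some subsequence approaches an
optimal point, and convergence of the distance to that point gives convergence of the whole sequence
(`exists_tendsto_mem_optimalSet`). -/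

section Projection

/-! ### Euclidean projections onto closed convex sets. -/

variable {n : ℕ} {K : Set (EuclideanSpace ℝ (Fin n))}

theorem isProjection_euclProj (hne : K.Nonempty) (hcl : IsClosed K) (hcv : Convex ℝ K)
    (y : EuclideanSpace ℝ (Fin n)) : IsProjection K y (euclProj K y) :=
  (euclProj_spec hne hcl hcv y _).2 rfl

theorem inner_sub_euclProj_nonpos (hcl : IsClosed K) (hcv : Convex ℝ K)
    (y : EuclideanSpace ℝ (Fin n)) {z : EuclideanSpace ℝ (Fin n)} (hz : z ∈ K) :
    inner ℝ (y - euclProj K y) (z - euclProj K y) ≤ 0 := by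
  obtain ⟨hq, hmin⟩ := isProjection_euclProj ⟨z, hz⟩ hcl hcv y
  refine (norm_eq_iInf_iff_real_inner_le_zero hcv hq).1 ?_ z hz
  have : Nonempty K := ⟨⟨z, hz⟩⟩
  have hb : BddBelow (Set.range fun w : K => ‖y - w‖) :=
    ⟨0, by rintro _ ⟨w, rfl⟩; exact norm_nonneg _⟩
  exact le_antisymm (le_ciInf fun w => hmin w w.2) (ciInf_le hb ⟨_, hq⟩)

/-- Law of cosines: the angle at `p` in the triangle `y p z` is not acute. -/
theorem norm_sub_sq_le_of_inner_nonpos {y p z : EuclideanSpace ℝ (Fin n)}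
    (h : inner ℝ (y - p) (z - p) ≤ 0) : ‖p - z‖ ^ 2 ≤ ‖y - z‖ ^ 2 - ‖y - p‖ ^ 2 := by
  have e : y - z = (y - p) - (z - p) := by abel
  rw [norm_sub_rev p z, e, norm_sub_sq_real (y - p)]
  linarith

theorem projDist_nonneg (K : Set (EuclideanSpace ℝ (Fin n))) (x : EuclideanSpace ℝ (Fin n)) :
    0 ≤ projDist K x := norm_nonneg _

theorem projDist_le_norm_sub (hcl : IsClosed K) (hcv : Convex ℝ K)
    (y : EuclideanSpace ℝ (Fin n)) {z : EuclideanSpace ℝ (Fin n)} (hz : z ∈ K) :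
    projDist K y ≤ ‖y - z‖ :=
  (isProjection_euclProj ⟨z, hz⟩ hcl hcv y).2 z hz

theorem projDist_le_add (hne : K.Nonempty) (hcl : IsClosed K) (hcv : Convex ℝ K)
    (x y : EuclideanSpace ℝ (Fin n)) : projDist K x ≤ ‖x - y‖ + projDist K y := by
  refine (projDist_le_norm_sub hcl hcv x (isProjection_euclProj hne hcl hcv y).1).trans ?_
  unfold projDist
  calc ‖x - euclProj K y‖ = ‖(x - y) + (y - euclProj K y)‖ := by congr 1; abel
    _ ≤ _ := norm_add_le _ _

theorem norm_euclProj_sub_euclProj_le (hne : K.Nonempty) (hcl : IsClosed K) (hcv : Convex ℝ K)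
    (x y : EuclideanSpace ℝ (Fin n)) : ‖euclProj K x - euclProj K y‖ ≤ ‖x - y‖ := by
  have h1 := inner_sub_euclProj_nonpos hcl hcv x (isProjection_euclProj hne hcl hcv y).1
  have h2 := inner_sub_euclProj_nonpos hcl hcv y (isProjection_euclProj hne hcl hcv x).1
  set p := euclProj K x
  set q := euclProj K y
  have h3 : ‖p - q‖ ^ 2 ≤ inner ℝ (x - y) (p - q) := by
    rw [← real_inner_self_eq_norm_sq]
    have e : inner ℝ (x - y) (p - q) - inner ℝ (p - q) (p - q)
        = -inner ℝ (x - p) (q - p) - inner ℝ (y - q) (p - q) := by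
      simp only [inner_sub_left, inner_sub_right]
      ring
    linarith
  have h4 := real_inner_le_norm (x - y) (p - q)
  by_contra! hlt
  nlinarith [norm_nonneg (x - y), norm_nonneg (p - q)]

theorem continuous_euclProj (hne : K.Nonempty) (hcl : IsClosed K) (hcv : Convex ℝ K) :
    Continuous (euclProj K) :=
  (LipschitzWith.of_dist_le_mul (K := 1) fun x y => by
    simpa [dist_eq_norm] using norm_euclProj_sub_euclProj_le hne hcl hcv x y).continuous

theorem continuous_projDist (hne : K.Nonempty) (hcl : IsClosed K) (hcv : Convex ℝ K) :
    Continuous (projDist K) :=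
  (continuous_id.sub (continuous_euclProj hne hcl hcv)).norm

end Projection

/-! ### The common descent inequality of the three updates. -/

section Steps

variable {n M : ℕ} {y z x' : EuclideanSpace ℝ (Fin n)} {p : Fin M → EuclideanSpace ℝ (Fin n)}

/-- By convexity of the squared norm, the obtuse-angle inequalities of the individual `p j` may be
averaged. -/
theorem AveragingStep.norm_sub_sq_le (hM : 0 < M) (h : AveragingStep y p x')
    (hz : ∀ j, inner ℝ (y - p j) (z - p j) ≤ 0) :
    ‖x' - z‖ ^ 2 ≤ ‖y - z‖ ^ 2 - (1 / (M : ℝ)) * ∑ j, ‖y - p j‖ ^ 2 := by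
  have hM' : (0 : ℝ) < M := by exact_mod_cast hM
  have e : x' - z = (1 / (M : ℝ)) • ∑ j, (p j - z) := by
    rw [h, Finset.sum_sub_distrib, smul_sub]
    congr 1
    rw [Finset.sum_const, Finset.card_univ, Fintype.card_fin, ← Nat.cast_smul_eq_nsmul ℝ,
      smul_smul, one_div_mul_cancel hM'.ne', one_smul]
  have h1 : ‖∑ j, (p j - z)‖ ^ 2 ≤ M * ∑ j, ‖p j - z‖ ^ 2 := by
    refine (pow_le_pow_left₀ (norm_nonneg _) (norm_sum_le _ _) 2).trans ?_
    simpa using sq_sum_le_card_mul_sum_sq (s := Finset.univ) (f := fun j => ‖p j - z‖)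
  have h2 : ∑ j, ‖p j - z‖ ^ 2 ≤ M * ‖y - z‖ ^ 2 - ∑ j, ‖y - p j‖ ^ 2 := by
    refine (Finset.sum_le_sum fun j _ => norm_sub_sq_le_of_inner_nonpos (hz j)).trans ?_
    simp [Finset.sum_sub_distrib]
  rw [e, norm_smul, mul_pow, Real.norm_of_nonneg (by positivity)]
  calc (1 / (M : ℝ)) ^ 2 * ‖∑ j, (p j - z)‖ ^ 2
      ≤ (1 / (M : ℝ)) ^ 2 * (M * (M * ‖y - z‖ ^ 2 - ∑ j, ‖y - p j‖ ^ 2)) := by gcongr; nlinarith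
    _ = _ := by field_simp

theorem average_sq_le (hM : 0 < M) {b : ℝ} (h : ∀ j, ‖y - p j‖ ^ 2 ≤ b) :
    (1 / (M : ℝ)) * ∑ j, ‖y - p j‖ ^ 2 ≤ b := by
  have hM' : (0 : ℝ) < M := by exact_mod_cast hM
  have : ∑ j, ‖y - p j‖ ^ 2 ≤ M * b := by
    simpa using Finset.sum_le_sum fun j (_ : j ∈ Finset.univ) => h j
  rw [one_div, inv_mul_le_iff₀ hM']
  exact this

/-- The inequality for the chosen `p i` suffices, since the largest squared distance dominates the
average. -/
theorem MaxSetStep.norm_sub_sq_le (hM : 0 < M) (h : MaxSetStep y p x')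
    (hz : ∀ j, inner ℝ (y - p j) (z - p j) ≤ 0) :
    ‖x' - z‖ ^ 2 ≤ ‖y - z‖ ^ 2 - (1 / (M : ℝ)) * ∑ j, ‖y - p j‖ ^ 2 := by
  obtain ⟨i, hi, rfl⟩ := h
  have h1 := norm_sub_sq_le_of_inner_nonpos (hz i)
  have h2 : (1 / (M : ℝ)) * ∑ j, ‖y - p j‖ ^ 2 ≤ ‖y - p i‖ ^ 2 := average_sq_le hM fun j => by
    have := hi j
    rw [norm_sub_rev, norm_sub_rev (p i)] at this
    gcongr
  linarith

theorem isClosed_samplePolyhedron (y : EuclideanSpace ℝ (Fin n))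
    (p : Fin M → EuclideanSpace ℝ (Fin n)) : IsClosed (samplePolyhedron y p) := by
  simp only [samplePolyhedron, Set.ofPred_forall]
  exact isClosed_iInter fun i => isClosed_le (by fun_prop) (by fun_prop)

theorem convex_samplePolyhedron (y : EuclideanSpace ℝ (Fin n))
    (p : Fin M → EuclideanSpace ℝ (Fin n)) : Convex ℝ (samplePolyhedron y p) := by
  simp only [samplePolyhedron, Set.ofPred_forall]
  exact convex_iInter fun i => convex_halfSpace_le (innerₛₗ ℝ (y - p i)).isLinear _

/-- The hypothesis on `z` says exactly that `z` lies in the polyhedron, so projecting gains `‖y -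
x'‖ ^ 2`. Since `x'` lies in every half-space, whose nearest point to `y` is `p j`, this gain
dominates each `‖y - p j‖ ^ 2`. -/
theorem PolyhedralStep.norm_sub_sq_le (hM : 0 < M) (h : PolyhedralStep y p x')
    (hz : ∀ j, inner ℝ (y - p j) (z - p j) ≤ 0) :
    ‖x' - z‖ ^ 2 ≤ ‖y - z‖ ^ 2 - (1 / (M : ℝ)) * ∑ j, ‖y - p j‖ ^ 2 := by
  have hcl := isClosed_samplePolyhedron y p
  have hcv := convex_samplePolyhedron y p
  have hzK : z ∈ samplePolyhedron y p := fun j => by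
    have := hz j
    rw [inner_sub_right] at this
    linarith
  have h1 := norm_sub_sq_le_of_inner_nonpos (inner_sub_euclProj_nonpos hcl hcv y hzK)
  have hxK := (isProjection_euclProj ⟨z, hzK⟩ hcl hcv y).1
  rw [← show x' = _ from h] at h1 hxK
  have h2 : (1 / (M : ℝ)) * ∑ j, ‖y - p j‖ ^ 2 ≤ ‖y - x'‖ ^ 2 := average_sq_le hM fun j => by
    have h3 : inner ℝ (y - p j) (x' - p j) ≤ 0 := by
      rw [inner_sub_right]
      linarith [hxK j]
    have h4 := norm_sub_sq_le_of_inner_nonpos h3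
    nlinarith [sq_nonneg ‖p j - x'‖]
  linarith

end Steps

/-! ### Deterministic convergence along a single path. -/

section Limit

variable {n : ℕ}

/-- Replacing `z` by a nearby `w ∈ S` changes all the distances by at most `dist z w`, uniformly in
`k`, so the Cauchy property passes to the closure. -/
theorem tendsto_norm_sub_of_mem_closure {x : ℕ → EuclideanSpace ℝ (Fin n)}
    {S : Set (EuclideanSpace ℝ (Fin n))}
    (h : ∀ z ∈ S, ∃ l, Tendsto (fun k => ‖x k - z‖) atTop (𝓝 l))
    {z : EuclideanSpace ℝ (Fin n)} (hz : z ∈ closure S) :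
    ∃ l, Tendsto (fun k => ‖x k - z‖) atTop (𝓝 l) := by
  refine cauchySeq_tendsto_of_complete (Metric.cauchySeq_iff.2 fun ε hε => ?_)
  obtain ⟨w, hwS, hw⟩ := Metric.mem_closure_iff.1 hz (ε / 3) (by positivity)
  obtain ⟨l, hl⟩ := h w hwS
  obtain ⟨N, hN⟩ := Metric.cauchySeq_iff.1 hl.cauchySeq (ε / 3) (by positivity)
  refine ⟨N, fun i hi j hj => ?_⟩
  have key : ∀ k, |‖x k - z‖ - ‖x k - w‖| ≤ dist z w := fun k => by
    refine (abs_norm_sub_norm_le _ _).trans (le_of_eq ?_)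
    rw [dist_comm, dist_eq_norm]
    congr 1
    abel
  have h1 := abs_le.1 (key i)
  have h2 := abs_le.1 (key j)
  have h3 := abs_lt.1 (Real.dist_eq _ _ ▸ hN i hi j hj)
  rw [Real.dist_eq, abs_lt]
  constructor <;> linarith

theorem exists_tendsto_mem_optimalSet {F : EuclideanSpace ℝ (Fin n) → ℝ} (hF : Continuous F)
    {K S : Set (EuclideanSpace ℝ (Fin n))} (hne : K.Nonempty) (hK : IsCompact K)
    (hcv : Convex ℝ K) (hS : optimalSet F K ⊆ closure S)
    {z : EuclideanSpace ℝ (Fin n)} (hz : z ∈ optimalSet F K)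
    {α : ℕ → ℝ} (hα_pos : ∀ k, 0 < α k) (hα : ¬ Summable α)
    {x : ℕ → EuclideanSpace ℝ (Fin n)}
    (hconv : ∀ z ∈ S, ∃ l, Tendsto (fun k => ‖x k - z‖) atTop (𝓝 l))
    (hgap : Summable fun k => α k * (F (euclProj K (x k)) - F z))
    (hdist : Tendsto (fun k => projDist K (x k)) atTop (𝓝 0)) :
    ∃ l ∈ optimalSet F K, Tendsto x atTop (𝓝 l) := by
  have hmem : ∀ k, euclProj K (x k) ∈ K := fun k =>
    (isProjection_euclProj hne hK.isClosed hcv _).1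
  -- If the gap eventually stayed above `1 / (j + 1)`, the summability of `hgap` would force `α` to
  -- be summable.
  have hfreq : ∀ j : ℕ, ∃ᶠ k in atTop, F (euclProj K (x k)) - F z < 1 / ((j : ℝ) + 1) := by
    intro j hev
    simp only [not_lt] at hev
    have hj : (0 : ℝ) < 1 / ((j : ℝ) + 1) := by positivity
    have hs : Summable fun k => α k * (1 / ((j : ℝ) + 1)) := by
      refine Summable.of_norm_bounded_eventually_nat hgap ?_
      filter_upwards [hev] with k hk
      rw [Real.norm_of_nonneg (mul_nonneg (hα_pos k).le hj.le)]
      exact mul_le_mul_of_nonneg_left hk (hα_pos k).le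
    exact hα ((summable_mul_right_iff hj.ne').1 hs)
  obtain ⟨φ, hφ, hφlt⟩ := extraction_forall_of_frequently hfreq
  obtain ⟨l, hlK, ψ, hψ, hψl⟩ := hK.tendsto_subseq fun j => hmem (φ j)
  have hFl : F l ≤ F z := by
    have h1 : Tendsto (fun j => F (euclProj K (x (φ (ψ j))))) atTop (𝓝 (F l)) :=
      (hF.tendsto l).comp hψl
    have h2 : Tendsto (fun j : ℕ => F z + 1 / ((ψ j : ℝ) + 1)) atTop (𝓝 (F z + 0)) :=
      tendsto_const_nhds.add (tendsto_one_div_add_atTop_nhds_zero_nat.comp hψ.tendsto_atTop)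
    rw [add_zero] at h2
    refine le_of_tendsto_of_tendsto' h1 h2 fun j => ?_
    have := hφlt (ψ j)
    linarith
  have hl : l ∈ optimalSet F K := ⟨hlK, fun w hw => hFl.trans (hz.2 w hw)⟩
  refine ⟨l, hl, ?_⟩
  have hsub : Tendsto (φ ∘ ψ) atTop atTop := hφ.tendsto_atTop.comp hψ.tendsto_atTop
  have hxsub : Tendsto (fun j => ‖x ((φ ∘ ψ) j) - l‖) atTop (𝓝 0) := by
    have h1 := (hdist.comp hsub).add (tendsto_iff_norm_sub_tendsto_zero.1 hψl)
    rw [add_zero] at h1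
    refine squeeze_zero (fun _ => norm_nonneg _) (fun j => ?_) h1
    have := norm_add_le (x ((φ ∘ ψ) j) - euclProj K (x ((φ ∘ ψ) j)))
      (euclProj K (x ((φ ∘ ψ) j)) - l)
    rw [sub_add_sub_cancel] at this
    exact this
  -- The full sequence of distances to `l` converges and has a subsequence tending to `0`, so its
  -- limit is `0`.
  obtain ⟨r, hr⟩ := tendsto_norm_sub_of_mem_closure hconv (hS hl)
  rw [tendsto_iff_norm_sub_tendsto_zero]
  rwa [tendsto_nhds_unique (hr.comp hsub) hxsub] at hr

end Limit

/-! ### Almost supermartingales and conditioning on the past. -/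

theorem ae_summable_of_summable_integral {Ω : Type*} {mΩ : MeasurableSpace Ω} {P : Measure Ω} {U : ℕ → Ω → ℝ}
    (hU : ∀ k, Integrable (U k) P) (hU0 : ∀ k a, 0 ≤ U k a)
    (hs : Summable fun k => ∫ a, U k a ∂P) : ∀ᵐ a ∂P, Summable fun k => U k a := by
  have h1 : ∫⁻ a, ∑' k, ENNReal.ofReal (U k a) ∂P ≠ ⊤ := by
    rw [lintegral_tsum fun k => (hU k).aestronglyMeasurable.aemeasurable.ennreal_ofReal]
    simp_rw [← ofReal_integral_eq_lintegral_ofReal (hU _) (ae_of_all _ (hU0 _))]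
    rw [← ENNReal.ofReal_tsum_of_nonneg (fun k => integral_nonneg (hU0 k)) hs]
    exact ENNReal.ofReal_ne_top
  filter_upwards [ae_lt_top' (AEMeasurable.tsum fun k =>
    (hU k).aestronglyMeasurable.aemeasurable.ennreal_ofReal) h1] with a ha
  have := ENNReal.summable_toReal ha.ne
  simpa [ENNReal.toReal_ofReal (hU0 _ a)] using this

/-- A form of the Robbins–Siegmund theorem with deterministic perturbations. -/
theorem ae_tendsto_and_summable_of_almost_supermartingale {Ω : Type*} {mΩ : MeasurableSpace Ω}
    {P : Measure Ω} [IsProbabilityMeasure P]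
    {ℱ : Filtration ℕ mΩ} {Z U : ℕ → Ω → ℝ} {e : ℕ → ℝ} (hZ : StronglyAdapted ℱ Z)
    (hZ0 : ∀ k a, 0 ≤ Z k a) (hZint : Integrable (Z 0) P)
    (hU : ∀ k, AEStronglyMeasurable (U k) P) (hU0 : ∀ k a, 0 ≤ U k a)
    (hUZ : ∀ k a, U k a ≤ Z k a + e k) (he0 : ∀ k, 0 ≤ e k) (he : Summable e)
    (hstep : ∀ k, ∀ A, MeasurableSet[ℱ k] A → ∫⁻ a in A, ENNReal.ofReal (Z (k + 1) a) ∂P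
      ≤ ∫⁻ a in A, ENNReal.ofReal (Z k a - U k a + e k) ∂P) :
    (∀ᵐ a ∂P, ∃ l, Tendsto (fun k => Z k a) atTop (𝓝 l)) ∧
      ∀ᵐ a ∂P, Summable fun k => U k a := by
  have hZm : ∀ k, AEStronglyMeasurable (Z k) P := fun k =>
    ((hZ k).mono (ℱ.le k)).aestronglyMeasurable
  have hUi_of : ∀ k, Integrable (Z k) P → Integrable (U k) P := fun k hk =>
    (hk.add (integrable_const (e k))).mono' (hU k) (ae_of_all _ fun a => by
      rw [Real.norm_of_nonneg (hU0 k a)]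
      exact hUZ k a)
  have hRi_of : ∀ k, Integrable (Z k) P → Integrable (fun a => Z k a - U k a + e k) P :=
    fun k hk => (hk.sub (hUi_of k hk)).add (integrable_const _)
  have hR0 : ∀ k a, 0 ≤ Z k a - U k a + e k := fun k a => by linarith [hUZ k a]
  -- `hstep` encodes a bound on the conditional expectation by lower integrals over `ℱ k`-measurable
  -- sets, so it need not presuppose integrability of `Z (k + 1)`; the case of the whole space
  -- proves it inductively.
  have hZi : ∀ k, Integrable (Z k) P := by
    intro k
    induction k with
    | zero => exact hZint
    | succ k ih =>
      refine ⟨hZm _, ?_⟩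
      rw [hasFiniteIntegral_iff_ofReal (ae_of_all _ (hZ0 _))]
      have h := hstep k Set.univ MeasurableSet.univ
      rw [Measure.restrict_univ] at h
      refine h.trans_lt ?_
      exact (hasFiniteIntegral_iff_ofReal (ae_of_all _ (hR0 k))).1 (hRi_of k ih).2
  have hUi : ∀ k, Integrable (U k) P := fun k => hUi_of k (hZi k)
  have hZc : ∀ k (c : ℝ), Integrable (fun a => Z k a + c) P := fun k c =>
    (hZi k).add (integrable_const c)
  have hZU : ∀ k, Integrable (fun a => Z k a - U k a) P := fun k => (hZi k).sub (hUi k)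
  have hle : ∀ k A, MeasurableSet[ℱ k] A → ∫ a in A, Z (k + 1) a ∂P
      ≤ ∫ a in A, (Z k a - U k a + e k) ∂P := by
    intro k A hA
    have h := hstep k A hA
    rw [← ofReal_integral_eq_lintegral_ofReal (hZi _).integrableOn (ae_of_all _ (hZ0 _)),
      ← ofReal_integral_eq_lintegral_ofReal (hRi_of k (hZi k)).integrableOn
        (ae_of_all _ (hR0 k))] at h
    exact (ENNReal.ofReal_le_ofReal_iff (integral_nonneg (hR0 k))).1 h
  have hsum : ∀ N, ∫ a, Z N a ∂P + ∑ k ∈ Finset.range N, ∫ a, U k a ∂P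
      ≤ ∫ a, Z 0 a ∂P + ∑ k ∈ Finset.range N, e k := by
    intro N
    induction N with
    | zero => simp
    | succ N ih =>
      have h := hle N Set.univ MeasurableSet.univ
      rw [Measure.restrict_univ, integral_add (hZU N) (integrable_const _),
        integral_sub (hZi N) (hUi N)] at h
      simp only [integral_const, probReal_univ, one_smul] at h
      rw [Finset.sum_range_succ, Finset.sum_range_succ]
      linarith
  have hpart : ∀ N, ∑ k ∈ Finset.range N, e k ≤ ∑' k, e k := fun N =>
    he.sum_le_tsum _ fun k _ => he0 k
  have hpart0 : ∀ N, 0 ≤ ∑ k ∈ Finset.range N, e k := fun N => Finset.sum_nonneg fun k _ => he0 k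
  have hIU0 : ∀ k, 0 ≤ ∫ a, U k a ∂P := fun k => integral_nonneg (hU0 k)
  constructor
  -- Subtracting the accumulated errors makes `Z` a supermartingale; `W` is its negative, an
  -- `L¹`-bounded submartingale.
  · let W : ℕ → Ω → ℝ := fun k a => -Z k a + ∑ j ∈ Finset.range k, e j
    have hWi : ∀ k, Integrable (W k) P := fun k => (hZi k).neg.add (integrable_const _)
    have hW : Submartingale W ℱ P := by
      refine submartingale_of_setIntegral_le_succ
        (fun k => (hZ k).neg.add stronglyMeasurable_const) hWi fun k A hA => ?_
      have h : ∫ a in A, (Z (k + 1) a - (Z k a + e k)) ∂P ≤ 0 := by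
        rw [integral_sub (hZi _).integrableOn (hZc k _).integrableOn]
        refine sub_nonpos.2 ((hle k A hA).trans ?_)
        refine integral_mono (hRi_of k (hZi k)).integrableOn
          (hZc k _).integrableOn fun a => ?_
        have := hU0 k a
        simp only
        linarith
      rw [← sub_nonneg, ← integral_sub (hWi _).integrableOn (hWi _).integrableOn, ← neg_nonpos,
        ← integral_neg]
      refine le_of_eq_of_le (integral_congr_ae (ae_of_all _ fun a => ?_)) h
      simp only [W, Finset.sum_range_succ]
      ring
    -- One `∑' k, e k` comes from `|W k| ≤ Z k + ∑' k, e k`, the other from the bound `hsum` on the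
    -- mean of `Z k`.
    have hbdd : ∀ k, eLpNorm (W k) 1 P
        ≤ ((∫ a, Z 0 a ∂P + 2 * ∑' k, e k).toNNReal : ENNReal) := by
      intro k
      rw [eLpNorm_one_eq_lintegral_enorm, ← ofReal_integral_norm_eq_lintegral_enorm (hWi k)]
      refine ENNReal.ofReal_le_ofReal ?_
      calc ∫ a, ‖W k a‖ ∂P ≤ ∫ a, (Z k a + ∑' k, e k) ∂P := by
            refine integral_mono (hWi k).norm (hZc k _) fun a => ?_
            simp only [W, Real.norm_eq_abs]
            rw [abs_le]
            constructor <;> linarith [hZ0 k a, hpart k, hpart0 k]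
        _ = ∫ a, Z k a ∂P + ∑' k, e k := by
            rw [integral_add (hZi k) (integrable_const _)]
            simp
        _ ≤ _ := by
            have := Finset.sum_nonneg fun j (_ : j ∈ Finset.range k) => hIU0 j
            linarith [hsum k, hpart k]
    filter_upwards [hW.exists_ae_tendsto_of_bdd hbdd] with a ⟨c, hc⟩
    refine ⟨∑' k, e k - c, ?_⟩
    refine (he.hasSum.tendsto_sum_nat.sub hc).congr fun k => ?_
    simp [W]
  · refine ae_summable_of_summable_integral hUi hU0 ?_
    refine summable_of_sum_range_le (c := ∫ a, Z 0 a ∂P + ∑' k, e k) hIU0 fun N => ?_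
    have := integral_nonneg (μ := P) (f := Z N) (hZ0 N)
    linarith [hsum N, hpart N]

/-- Integrating out an independent random variable `Y`. -/
theorem setLIntegral_comp_eq_of_indep {Ω E₁ E₂ : Type*} {𝒢 mΩ : MeasurableSpace Ω}
    [MeasurableSpace E₁] [MeasurableSpace E₂] {P : Measure Ω} [IsProbabilityMeasure P] (h𝒢 : 𝒢 ≤ mΩ)
    {x : Ω → E₁} (hx : Measurable[𝒢] x) {Y : Ω → E₂} (hY : Measurable Y)
    (hind : Indep 𝒢 (MeasurableSpace.comap Y inferInstance) P)
    {A : Set Ω} (hA : MeasurableSet[𝒢] A) {ψ : E₁ → E₂ → ENNReal}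
    (hψ : Measurable (Function.uncurry ψ)) :
    ∫⁻ a in A, ψ (x a) (Y a) ∂P = ∫⁻ a in A, ∫⁻ y, ψ (x a) y ∂(P.map Y) ∂P := by
  -- Carrying the indicator of `A` along with `x` makes the set integral a function of two
  -- independent variables `q` and `Y`, to which Tonelli applies.
  let q : Ω → ENNReal × E₁ := fun a => (A.indicator 1 a, x a)
  have hq𝒢 : Measurable[𝒢] q :=
    Measurable.prodMk (Measurable.indicator (@measurable_one _ Ω _ 𝒢 _) hA) hx
  have hq : Measurable q := hq𝒢.mono h𝒢 le_rfl
  have hqY : IndepFun q Y P := by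
    rw [IndepFun_iff_Indep]
    exact indep_of_indep_of_le_left hind hq𝒢.comap_le
  have hmap := hqY.map_prod_eq_prod_map_map hq.aemeasurable hY.aemeasurable
  have := Measure.isProbabilityMeasure_map (μ := P) hY.aemeasurable
  have := Measure.isProbabilityMeasure_map (μ := P) hq.aemeasurable
  have hA' := h𝒢 A hA
  have hind1 : ∀ (h : Ω → ENNReal), ∫⁻ a in A, h a ∂P = ∫⁻ a, A.indicator 1 a * h a ∂P := by
    intro h
    rw [← lintegral_indicator hA']
    refine lintegral_congr fun a => ?_
    by_cases ha : a ∈ A <;> simp [ha]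
  have hΨ : Measurable fun r : (ENNReal × E₁) × E₂ => r.1.1 * ψ r.1.2 r.2 :=
    (measurable_fst.comp measurable_fst).mul
      (hψ.comp ((measurable_snd.comp measurable_fst).prodMk measurable_snd))
  rw [hind1, hind1]
  calc ∫⁻ a, A.indicator 1 a * ψ (x a) (Y a) ∂P
      = ∫⁻ r, r.1.1 * ψ r.1.2 r.2 ∂(P.map fun a => (q a, Y a)) := by
        rw [lintegral_map hΨ (hq.prodMk hY)]
    _ = ∫⁻ r, ∫⁻ y, r.1 * ψ r.2 y ∂(P.map Y) ∂(P.map q) := by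
        rw [hmap, lintegral_prod _ hΨ.aemeasurable]
    _ = ∫⁻ a, ∫⁻ y, (q a).1 * ψ (q a).2 y ∂(P.map Y) ∂P := by
        rw [lintegral_map hΨ.lintegral_prod_right hq]
    _ = _ := by
        refine lintegral_congr fun a => ?_
        exact lintegral_const_mul _ (hψ.comp measurable_prodMk_left)

/-! ### The expected one-step estimate. -/

section OneStep

variable {n m M : ℕ}

/-- The average squared distance of `y` to the sets with indices `σ 0, …, σ (M - 1)`. -/
noncomputable def sampledResidual (X : Fin m → Set (EuclideanSpace ℝ (Fin n)))
    (y : EuclideanSpace ℝ (Fin n)) (σ : Fin M → Fin m) : ℝ :=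
  (1 / (M : ℝ)) * ∑ j, projDist (X (σ j)) y ^ 2

theorem sampledResidual_nonneg (X : Fin m → Set (EuclideanSpace ℝ (Fin n)))
    (y : EuclideanSpace ℝ (Fin n)) (σ : Fin M → Fin m) : 0 ≤ sampledResidual X y σ :=
  mul_nonneg (by positivity) (Finset.sum_nonneg fun _ _ => sq_nonneg _)

theorem continuous_sampledResidual {X : Fin m → Set (EuclideanSpace ℝ (Fin n))}
    (hne : (feasibleSet X).Nonempty) (hcl : ∀ i, IsClosed (X i)) (hcv : ∀ i, Convex ℝ (X i))
    (σ : Fin M → Fin m) : Continuous fun y => sampledResidual X y σ := by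
  refine continuous_const.mul (continuous_finsetSum _ fun j _ => ?_)
  exact (continuous_projDist (hne.mono (Set.iInter_subset X _)) (hcl _) (hcv _)).pow 2

theorem measurable_uncurry_sampledResidual {X : Fin m → Set (EuclideanSpace ℝ (Fin n))}
    (hne : (feasibleSet X).Nonempty) (hcl : ∀ i, IsClosed (X i)) (hcv : ∀ i, Convex ℝ (X i)) :
    Measurable fun q : EuclideanSpace ℝ (Fin n) × (Fin M → Fin m) =>
      sampledResidual X q.1 q.2 :=
  measurable_from_prod_countable_left fun τ => (continuous_sampledResidual hne hcl hcv τ).measurable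

theorem measurable_sampledResidual {X : Fin m → Set (EuclideanSpace ℝ (Fin n))}
    (hne : (feasibleSet X).Nonempty) (hcl : ∀ i, IsClosed (X i)) (hcv : ∀ i, Convex ℝ (X i))
    {Ω : Type*} [MeasurableSpace Ω] {y : Ω → EuclideanSpace ℝ (Fin n)} (hy : Measurable y)
    {σ : Ω → Fin M → Fin m} (hσ : Measurable σ) :
    Measurable fun a => sampledResidual X (y a) (σ a) := by
  have h := measurable_uncurry_sampledResidual (M := M) hne hcl hcv
  have h₁ : Measurable fun a => (y a, σ a) := hy.prodMk hσ
  have h₂ := h.comp h₁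
  exact h₂

theorem sampledResidual_le {X : Fin m → Set (EuclideanSpace ℝ (Fin n))}
    (hcl : ∀ i, IsClosed (X i)) (hcv : ∀ i, Convex ℝ (X i)) (hM : 0 < M)
    (y : EuclideanSpace ℝ (Fin n)) (σ : Fin M → Fin m) {z : EuclideanSpace ℝ (Fin n)}
    (hz : z ∈ feasibleSet X) : sampledResidual X y σ ≤ ‖y - z‖ ^ 2 :=
  average_sq_le (p := fun j => euclProj (X (σ j)) y) hM fun j =>
    pow_le_pow_left₀ (norm_nonneg _)
      (projDist_le_norm_sub (hcl _) (hcv _) y (Set.mem_iInter.1 hz (σ j))) 2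

theorem isProbabilityMeasure_uniformOn_injective (hMm : M ≤ m) :
    IsProbabilityMeasure (uniformOn {σ : Fin M → Fin m | Function.Injective σ}) :=
  isProbabilityMeasure_uniformOn (Set.toFinite _) ⟨_, Fin.castLE_injective hMm⟩

/-- Every constraint attaining the maximum in the regularity condition is sampled with positive
probability. A crude bound suffices: for each index `i` keep a single injective tuple `σ i` starting
with `i`, and in its residual only the first summand. -/
theorem exists_mul_projDist_sq_le_integral_sampledResidual
    {X : Fin m → Set (EuclideanSpace ℝ (Fin n))} (hreg : LinearRegularity X)
    (hM : 0 < M) (hMm : M ≤ m) :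
    ∃ c : ℝ, 0 < c ∧ ∀ y, c * projDist (feasibleSet X) y ^ 2
      ≤ ∫ σ, sampledResidual X y σ ∂(uniformOn {σ : Fin M → Fin m | Function.Injective σ}) := by
  obtain ⟨η, hη, -, hreg⟩ := hreg
  have hM' : (0 : ℝ) < M := by exact_mod_cast hM
  have := isProbabilityMeasure_uniformOn_injective hMm
  set μ := uniformOn {σ : Fin M → Fin m | Function.Injective σ}
  have : Nonempty (Fin m) := ⟨⟨0, hM.trans_le hMm⟩⟩
  have hex : ∀ i : Fin m, ∃ σ : Fin M → Fin m, Function.Injective σ ∧ σ ⟨0, hM⟩ = i := fun i =>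
    ⟨Equiv.swap (Fin.castLE hMm ⟨0, hM⟩) i ∘ Fin.castLE hMm,
      (Equiv.injective _).comp (Fin.castLE_injective hMm), by simp⟩
  choose σ hσ hσ0 using hex
  have hpos : ∀ i, 0 < μ.real {σ i} := fun i => by
    refine ENNReal.toReal_pos (fun h => ?_) (measure_ne_top _ _)
    rw [uniformOn_eq_zero_iff (Set.toFinite _)] at h
    exact Set.notMem_empty (σ i) (h ▸ ⟨hσ i, rfl⟩)
  obtain ⟨i₀, hi₀⟩ := Finite.exists_min fun i => μ.real {σ i}
  refine ⟨μ.real {σ i₀} * (1 / M) * η, by have := hpos i₀; positivity, fun y => ?_⟩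
  obtain ⟨i, hi⟩ := exists_eq_ciSup_of_finite (f := fun i => ‖y - euclProj (X i) y‖ ^ 2)
  have h1 : η * projDist (feasibleSet X) y ^ 2 ≤ projDist (X i) y ^ 2 :=
    (hreg y).trans_eq hi.symm
  have h2 : (1 / (M : ℝ)) * projDist (X i) y ^ 2 ≤ sampledResidual X y (σ i) := by
    refine mul_le_mul_of_nonneg_left ?_ (by positivity)
    have := Finset.single_le_sum (f := fun j => projDist (X (σ i j)) y ^ 2)
      (fun j _ => sq_nonneg _) (Finset.mem_univ ⟨0, hM⟩)
    simpa only [hσ0] using this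
  rw [integral_fintype Integrable.of_finite]
  calc μ.real {σ i₀} * (1 / M) * η * projDist (feasibleSet X) y ^ 2
      = μ.real {σ i₀} * ((1 / M) * (η * projDist (feasibleSet X) y ^ 2)) := by ring
    _ ≤ μ.real {σ i} * sampledResidual X y (σ i) :=
        mul_le_mul (hi₀ i) ((mul_le_mul_of_nonneg_left h1 (by positivity)).trans h2)
          (by positivity) (hpos i).le
    _ ≤ _ := Finset.single_le_sum (f := fun τ => μ.real {τ} • sampledResidual X y τ)
        (fun τ _ => mul_nonneg measureReal_nonneg (sampledResidual_nonneg X y τ))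
        (Finset.mem_univ (σ i))

theorem norm_integral_le_of_integral_sq_le {V E : Type*} [MeasurableSpace V]
    [NormedAddCommGroup E] [NormedSpace ℝ E] {ν : Measure V} [IsProbabilityMeasure ν]
    {h : V → E} (hh : MemLp h 2 ν) {B : ℝ} (hB : 0 ≤ B) (hle : ∫ w, ‖h w‖ ^ 2 ∂ν ≤ B ^ 2) :
    ‖∫ w, h w ∂ν‖ ≤ B := by
  -- Nonnegativity of the variance serves as Jensen's inequality for the square.
  have h1 := variance_nonneg (fun w => ‖h w‖) ν
  rw [variance_eq_sub hh.norm] at h1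
  simp only [Pi.pow_apply] at h1
  have h2 : (∫ w, ‖h w‖ ∂ν) ^ 2 ≤ B ^ 2 := by linarith
  exact (norm_integral_le_integral_norm h).trans (abs_le_of_sq_le_sq h2 hB |> le_of_abs_le)

variable {V : Type*} [MeasurableSpace V] {ν : Measure V}
  {f : EuclideanSpace ℝ (Fin n) → V → ℝ}
  {g : EuclideanSpace ℝ (Fin n) → V → EuclideanSpace ℝ (Fin n)}
  {X : Fin m → Set (EuclideanSpace ℝ (Fin n))}

theorem BasicAssumptions.isClosed_feasibleSet (hb : BasicAssumptions ν f g X) :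
    IsClosed (feasibleSet X) := isClosed_iInter hb.isClosed_X

theorem BasicAssumptions.convex_feasibleSet (hb : BasicAssumptions ν f g X) :
    Convex ℝ (feasibleSet X) := convex_iInter hb.convex_X

/-- The index `i` is needed: an empty intersection is the whole space. -/
theorem BasicAssumptions.isCompact_feasibleSet (hb : BasicAssumptions ν f g X) (i : Fin m) :
    IsCompact (feasibleSet X) := by
  obtain ⟨D, -, hD⟩ := hb.bounded_X
  refine Metric.isCompact_of_isClosed_isBounded hb.isClosed_feasibleSet ?_
  refine (Metric.isBounded_iff.2 ⟨D, fun x hx z hz => ?_⟩ : Bornology.IsBounded (X i)).subset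
    (Set.iInter_subset X i)
  rw [dist_eq_norm]
  exact hD i x hx z hz

theorem BasicAssumptions.objective_sub_le [IsProbabilityMeasure ν]
    (hb : BasicAssumptions ν f g X) {B : ℝ} (hB : 0 ≤ B)
    (hg : ∀ x, MemLp (g x) 2 ν ∧ ∫ w, ‖g x w‖ ^ 2 ∂ν ≤ B ^ 2) (x y : EuclideanSpace ℝ (Fin n)) :
    expectedObjective ν f x - expectedObjective ν f y ≤ B * ‖x - y‖ := by
  have h1 := hb.unbiased x y
  have h2 := real_inner_le_norm (∫ w, g x w ∂ν) (x - y)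
  have h3 := mul_le_mul_of_nonneg_right
    (norm_integral_le_of_integral_sq_le (hg x).1 hB (hg x).2) (norm_nonneg (x - y))
  rw [← neg_sub x y, inner_neg_right] at h1
  linarith

/-- An upper bound for the squared distance of the next iterate to `z`, as a function of the
current iterate and of the samples. -/
noncomputable def stepBound (g : EuclideanSpace ℝ (Fin n) → V → EuclideanSpace ℝ (Fin n))
    (X : Fin m → Set (EuclideanSpace ℝ (Fin n))) (a : ℝ) (z x : EuclideanSpace ℝ (Fin n))
    (q : V × (Fin M → Fin m)) : ℝ :=
  ‖gradientStep g a x q.1 - z‖ ^ 2 - sampledResidual X (gradientStep g a x q.1) q.2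

theorem BasicAssumptions.measurable_gradientStep (hb : BasicAssumptions ν f g X) (a : ℝ)
    {Ω : Type*} [MeasurableSpace Ω] {x : Ω → EuclideanSpace ℝ (Fin n)} (hx : Measurable x)
    {w : Ω → V} (hw : Measurable w) : Measurable fun r => gradientStep g a (x r) (w r) := by
  have h : Measurable fun r => g (x r) (w r) := hb.measurable_g.comp (hx.prodMk hw)
  exact hx.sub (h.const_smul a)

theorem BasicAssumptions.measurable_stepBound (hb : BasicAssumptions ν f g X) (a : ℝ)
    (z : EuclideanSpace ℝ (Fin n)) :
    Measurable (Function.uncurry (stepBound (M := M) g X a z)) := by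
  have hy : Measurable fun r : EuclideanSpace ℝ (Fin n) × V × (Fin M → Fin m) =>
      gradientStep g a r.1 r.2.1 :=
    hb.measurable_gradientStep a measurable_fst (measurable_fst.comp measurable_snd)
  have h1 : Measurable fun r : EuclideanSpace ℝ (Fin n) × V × (Fin M → Fin m) =>
      ‖gradientStep g a r.1 r.2.1 - z‖ ^ 2 := (hy.sub_const z).norm.pow_const 2
  have hs : Measurable fun r : EuclideanSpace ℝ (Fin n) × V × (Fin M → Fin m) => r.2.2 :=
    measurable_snd.comp measurable_snd
  have h2 := measurable_sampledResidual hb.nonempty_feasible hb.isClosed_X hb.convex_X hy hs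
  exact h1.sub h2

theorem BasicAssumptions.stepBound_nonneg (hb : BasicAssumptions ν f g X) (hM : 0 < M) (a : ℝ)
    {z : EuclideanSpace ℝ (Fin n)} (hz : z ∈ feasibleSet X) (x : EuclideanSpace ℝ (Fin n))
    (q : V × (Fin M → Fin m)) : 0 ≤ stepBound g X a z x q :=
  sub_nonneg.2 (sampledResidual_le hb.isClosed_X hb.convex_X hM _ _ hz)

/-- The expected decrease of the squared distance to `z`. -/
noncomputable def expectedDecrease (ν : Measure V) (f : EuclideanSpace ℝ (Fin n) → V → ℝ)
    (X : Fin m → Set (EuclideanSpace ℝ (Fin n))) (c a : ℝ) (z x : EuclideanSpace ℝ (Fin n)) : ℝ :=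
  2 * a * (expectedObjective ν f (euclProj (feasibleSet X) x) - expectedObjective ν f z)
    + c / 4 * projDist (feasibleSet X) x ^ 2

/-- The residual contributes `-c / 2` times the squared distance and Young's inequality gives back
`c / 4`, which leaves the `c / 4` of `expectedDecrease`. The terms `1`, `c` and `4 / c` of the error
come from the gradient step, from comparing the distances of `x` and `y`, and from Young's
inequality. -/
theorem BasicAssumptions.integral_stepBound_le [IsProbabilityMeasure ν]
    (hb : BasicAssumptions ν f g X) (hM : 0 < M)
    {B : ℝ} (hB : 0 ≤ B) (hg : ∀ x, MemLp (g x) 2 ν ∧ ∫ w, ‖g x w‖ ^ 2 ∂ν ≤ B ^ 2)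
    {μ : Measure (Fin M → Fin m)} [IsProbabilityMeasure μ] {c : ℝ} (hc : 0 < c)
    (hμ : ∀ y, c * projDist (feasibleSet X) y ^ 2 ≤ ∫ σ, sampledResidual X y σ ∂μ)
    {a : ℝ} (ha : 0 ≤ a) {z : EuclideanSpace ℝ (Fin n)} (hz : z ∈ feasibleSet X)
    (x : EuclideanSpace ℝ (Fin n)) :
    Integrable (stepBound g X a z x) (ν.prod μ) ∧
    ∫ q, stepBound g X a z x q ∂(ν.prod μ)
      ≤ ‖x - z‖ ^ 2 - expectedDecrease ν f X c a z x + B ^ 2 * (1 + c + 4 / c) * a ^ 2 := by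
  obtain ⟨hgx, hgB⟩ := hg x
  set d := projDist (feasibleSet X)
  set π := euclProj (feasibleSet X)
  have hd0 : 0 ≤ d x := projDist_nonneg _ _
  have hgi : Integrable (g x) ν := hgx.integrable (by norm_num)
  have hg2 : Integrable (fun w => ‖g x w‖ ^ 2) ν := hgx.integrable_norm_pow (by norm_num)
  have hin : Integrable (fun w => inner ℝ (x - z) (g x w)) ν := hgi.const_inner _
  have hsq : ∀ w, ‖gradientStep g a x w - z‖ ^ 2
      = ‖x - z‖ ^ 2 - 2 * a * inner ℝ (x - z) (g x w) + a ^ 2 * ‖g x w‖ ^ 2 := fun w => by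
    rw [gradientStep, sub_right_comm, norm_sub_sq_real, inner_smul_right, norm_smul, mul_pow,
      Real.norm_eq_abs, sq_abs]
    ring
  have hc1 : Integrable (fun w => ‖x - z‖ ^ 2 - 2 * a * inner ℝ (x - z) (g x w)) ν :=
    (integrable_const _).sub (hin.const_mul _)
  have hyi : Integrable (fun w => ‖gradientStep g a x w - z‖ ^ 2) ν := by
    simp_rw [hsq]
    exact hc1.add (hg2.const_mul _)
  have hyI : ∫ w, ‖gradientStep g a x w - z‖ ^ 2 ∂ν
      ≤ ‖x - z‖ ^ 2 - 2 * a * inner ℝ (x - z) (∫ w, g x w ∂ν) + a ^ 2 * B ^ 2 := by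
    simp_rw [hsq]
    rw [integral_add hc1 (hg2.const_mul _), integral_sub (integrable_const _) (hin.const_mul _),
      integral_const_mul, integral_const_mul, integral_inner hgi]
    simp only [integral_const, probReal_univ, one_smul]
    gcongr
  have hyi' : Integrable (fun q : V × (Fin M → Fin m) => ‖gradientStep g a x q.1 - z‖ ^ 2)
      (ν.prod μ) := hyi.comp_fst μ
  have hri : Integrable (fun q : V × (Fin M → Fin m) =>
      sampledResidual X (gradientStep g a x q.1) q.2) (ν.prod μ) := by
    refine hyi'.mono' ?_ (ae_of_all _ fun q => ?_)
    · exact (measurable_sampledResidual hb.nonempty_feasible hb.isClosed_X hb.convex_X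
        (hb.measurable_gradientStep a measurable_const measurable_fst)
        measurable_snd).aestronglyMeasurable
    · rw [Real.norm_of_nonneg (sampledResidual_nonneg _ _ _)]
      exact sampledResidual_le hb.isClosed_X hb.convex_X hM _ _ hz
  have hrI : c * (d x ^ 2 / 2 - a ^ 2 * B ^ 2)
      ≤ ∫ q, sampledResidual X (gradientStep g a x q.1) q.2 ∂(ν.prod μ) := by
    rw [integral_prod _ hri]
    -- From `d x ≤ a * ‖g x w‖ + d y` and `(s + t)² ≤ 2 s² + 2 t²`.
    have hpt : ∀ w, c * (d x ^ 2 / 2 - a ^ 2 * ‖g x w‖ ^ 2)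
        ≤ ∫ σ, sampledResidual X (gradientStep g a x w) σ ∂μ := fun w => by
      refine le_trans (mul_le_mul_of_nonneg_left ?_ hc.le) (hμ (gradientStep g a x w))
      have h1 := projDist_le_add hb.nonempty_feasible hb.isClosed_feasibleSet
        hb.convex_feasibleSet x (gradientStep g a x w)
      rw [gradientStep, sub_sub_cancel, norm_smul, Real.norm_of_nonneg ha] at h1
      have h2 := pow_le_pow_left₀ hd0 h1 2
      have h3 := sq_nonneg (a * ‖g x w‖ - d (gradientStep g a x w))
      rw [gradientStep] at h3 ⊢
      rw [← mul_pow]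
      nlinarith
    have hi0 : Integrable (fun w => d x ^ 2 / 2 - a ^ 2 * ‖g x w‖ ^ 2) ν :=
      (integrable_const _).sub (hg2.const_mul _)
    refine le_trans ?_ (integral_mono (hi0.const_mul c) hri.integral_prod_left hpt)
    rw [integral_const_mul, integral_sub (integrable_const _) (hg2.const_mul _),
      integral_const_mul]
    simp only [integral_const, probReal_univ, one_smul]
    gcongr
  refine ⟨hyi'.sub hri, ?_⟩
  have hsplit : ∫ q, stepBound g X a z x q ∂(ν.prod μ)
      = ∫ w, ‖gradientStep g a x w - z‖ ^ 2 ∂ν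
        - ∫ q, sampledResidual X (gradientStep g a x q.1) q.2 ∂(ν.prod μ) := by
    simp only [stepBound]
    rw [integral_sub hyi' hri, integral_fun_fst (fun w => ‖gradientStep g a x w - z‖ ^ 2)]
    simp
  have hsub : expectedObjective ν f x - expectedObjective ν f z
      ≤ inner ℝ (x - z) (∫ w, g x w ∂ν) := by
    have h1 := hb.unbiased x z
    rw [← neg_sub x z, inner_neg_right, real_inner_comm] at h1
    linarith
  have hlip : expectedObjective ν f (π x) - expectedObjective ν f x ≤ B * d x := by
    have := hb.objective_sub_le hB hg (π x) x
    rwa [norm_sub_rev] at this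
  have hyoung : 2 * a * (B * d x) ≤ c / 4 * d x ^ 2 + 4 / c * (a ^ 2 * B ^ 2) := by
    have h1 : c / 4 * d x ^ 2 + 4 / c * (a ^ 2 * B ^ 2) - 2 * a * (B * d x)
        = c / 4 * (d x - 4 / c * (a * B)) ^ 2 := by
      field_simp
      ring
    have h2 : 0 ≤ c / 4 * (d x - 4 / c * (a * B)) ^ 2 := by positivity
    linarith
  have h1 := mul_le_mul_of_nonneg_left hsub (by positivity : 0 ≤ 2 * a)
  have h2 := mul_le_mul_of_nonneg_left hlip (by positivity : 0 ≤ 2 * a)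
  rw [hsplit, expectedDecrease]
  linarith

end OneStep

/-! ### Independence and laws of the samples. -/

section Oracle

variable {Ω V : Type*} {mΩ : MeasurableSpace Ω} [MeasurableSpace V] {m M : ℕ}
  {P : Measure Ω} {ν : Measure V} {v : ℕ → Ω → V} {s : ℕ → Ω → Fin M → Fin m}

theorem IsSamplingOracle.measurable_samples (h : IsSamplingOracle P ν v s) (k : ℕ) :
    Measurable fun a => (v k a, s k a) := (h.measurable_v k).prodMk (h.measurable_s k)

theorem IsSamplingOracle.sampleHistory_le (h : IsSamplingOracle P ν v s) (k : ℕ) :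
    sampleHistory v s k ≤ mΩ := iSup_le fun j => (h.measurable_samples j).comap_le

/-- The filtration generated by the samples of the oracle. -/
def IsSamplingOracle.filtration (h : IsSamplingOracle P ν v s) : Filtration ℕ mΩ where
  seq := sampleHistory v s
  mono' _ _ hkl := iSup_le fun j => le_iSup_of_le (Fin.castLE hkl j) le_rfl
  le' := h.sampleHistory_le

/-- The index sets `{j | j < k}` and `{k}` are disjoint. -/
theorem IsSamplingOracle.indep_sampleHistory (h : IsSamplingOracle P ν v s) (k : ℕ) :
    Indep (sampleHistory v s k)
      (MeasurableSpace.comap (fun a => (v k a, s k a)) inferInstance) P := by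
  have h1 := indep_iSup_of_disjoint (fun j => (h.measurable_samples j).comap_le) h.indep_calls
    (Set.disjoint_singleton_right.2 (Set.notMem_Iio.2 (le_refl k)))
  rw [iSup_singleton] at h1
  refine indep_of_indep_of_le_left h1 (iSup_le fun j => ?_)
  exact le_iSup₂_of_le (f := fun (i : ℕ) (_ : i ∈ Set.Iio k) =>
    MeasurableSpace.comap (fun a => (v i a, s i a)) inferInstance) (j : ℕ) j.2 le_rfl

theorem IsSamplingOracle.map_samples [IsFiniteMeasure P] (h : IsSamplingOracle P ν v s) (k : ℕ) :
    P.map (fun a => (v k a, s k a))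
      = ν.prod (uniformOn {σ : Fin M → Fin m | Function.Injective σ}) := by
  rw [(h.indep_v_s k).map_prod_eq_prod_map_map (h.measurable_v k).aemeasurable
    (h.measurable_s k).aemeasurable, h.law_v, h.law_s]

end Oracle

/-! ### Almost sure convergence of the iterates. -/

theorem BasicAssumptions.expectedDecrease_nonneg {n m : ℕ} {V : Type*} [MeasurableSpace V]
    {ν : Measure V} {f : EuclideanSpace ℝ (Fin n) → V → ℝ}
    {g : EuclideanSpace ℝ (Fin n) → V → EuclideanSpace ℝ (Fin n)}
    {X : Fin m → Set (EuclideanSpace ℝ (Fin n))} (hb : BasicAssumptions ν f g X)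
    {c a : ℝ} (hc : 0 ≤ c) (ha : 0 ≤ a) {z : EuclideanSpace ℝ (Fin n)}
    (hz : z ∈ optimalSet (expectedObjective ν f) (feasibleSet X)) (x : EuclideanSpace ℝ (Fin n)) :
    0 ≤ expectedDecrease ν f X c a z x := by
  have h := hz.2 _ (isProjection_euclProj hb.nonempty_feasible hb.isClosed_feasibleSet
    hb.convex_feasibleSet x).1
  have := sub_nonneg.2 h
  unfold expectedDecrease
  positivity

theorem ae_tendsto_norm_sub_and_summable_expectedDecrease
    {Ω V : Type*} [MeasurableSpace Ω] [MeasurableSpace V] {n m M : ℕ}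
    {P : Measure Ω} [IsProbabilityMeasure P] {ν : Measure V} [IsProbabilityMeasure ν]
    {f : EuclideanSpace ℝ (Fin n) → V → ℝ}
    {g : EuclideanSpace ℝ (Fin n) → V → EuclideanSpace ℝ (Fin n)}
    {X : Fin m → Set (EuclideanSpace ℝ (Fin n))} (hb : BasicAssumptions ν f g X)
    (hM : 0 < M) (hMm : M ≤ m)
    {B : ℝ} (hB : 0 ≤ B) (hg : ∀ x, MemLp (g x) 2 ν ∧ ∫ w, ‖g x w‖ ^ 2 ∂ν ≤ B ^ 2)
    {c : ℝ} (hc : 0 < c) (hcX : ∀ y, c * projDist (feasibleSet X) y ^ 2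
      ≤ ∫ σ, sampledResidual X y σ ∂(uniformOn {σ : Fin M → Fin m | Function.Injective σ}))
    {v : ℕ → Ω → V} {s : ℕ → Ω → Fin M → Fin m} (horacle : IsSamplingOracle P ν v s)
    {α : ℕ → ℝ} (hα_pos : ∀ k, 0 < α k) (hα_sq : Summable (fun k => α k ^ 2))
    {x₀ : EuclideanSpace ℝ (Fin n)} {x : ℕ → Ω → EuclideanSpace ℝ (Fin n)}
    (hinit : ∀ a, x 0 a = x₀) (hadapted : ∀ k, Measurable[sampleHistory v s k] (x k))
    {z : EuclideanSpace ℝ (Fin n)}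
    (hz : z ∈ optimalSet (expectedObjective ν f) (feasibleSet X))
    (hstep : ∀ k a, ‖x (k + 1) a - z‖ ^ 2 ≤ stepBound g X (α k) z (x k a) (v k a, s k a)) :
    (∀ᵐ a ∂P, ∃ l, Tendsto (fun k => ‖x k a - z‖ ^ 2) atTop (𝓝 l)) ∧
      ∀ᵐ a ∂P, Summable fun k => expectedDecrease ν f X c (α k) z (x k a) := by
  have := isProbabilityMeasure_uniformOn_injective hMm
  set C := B ^ 2 * (1 + c + 4 / c)
  have hC : 0 ≤ C := by positivity
  have hxm : ∀ k, Measurable (x k) := fun k =>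
    (hadapted k).mono (horacle.sampleHistory_le k) le_rfl
  have hdec : ∀ k, Continuous (expectedDecrease ν f X c (α k) z) := fun k =>
    (continuous_const.mul ((hb.continuous_F.comp (continuous_euclProj hb.nonempty_feasible
      hb.isClosed_feasibleSet hb.convex_feasibleSet)).sub continuous_const)).add
      (continuous_const.mul ((continuous_projDist hb.nonempty_feasible
      hb.isClosed_feasibleSet hb.convex_feasibleSet).pow 2))
  have hone : ∀ k y, Integrable (stepBound g X (α k) z y)
        (ν.prod (uniformOn {σ : Fin M → Fin m | Function.Injective σ})) ∧
      ∫ q, stepBound g X (α k) z y q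
        ∂(ν.prod (uniformOn {σ : Fin M → Fin m | Function.Injective σ}))
        ≤ ‖y - z‖ ^ 2 - expectedDecrease ν f X c (α k) z y + C * α k ^ 2 := fun k y =>
    hb.integral_stepBound_le hM hB hg hc hcX (hα_pos k).le hz.1 y
  have hnn : ∀ k y (q : V × (Fin M → Fin m)), 0 ≤ stepBound g X (α k) z y q := fun k y q =>
    hb.stepBound_nonneg hM (α k) hz.1 y q
  refine ae_tendsto_and_summable_of_almost_supermartingale (ℱ := horacle.filtration)
    (e := fun k => C * α k ^ 2) (fun k => ?_) (fun k a => sq_nonneg _) ?_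
    (fun k => ((hdec k).measurable.comp (hxm k)).aestronglyMeasurable)
    (fun k a => hb.expectedDecrease_nonneg hc.le (hα_pos k).le hz _) (fun k a => ?_)
    (fun k => by positivity) (hα_sq.mul_left C) (fun k A hA => ?_)
  · have hcont : Continuous fun y : EuclideanSpace ℝ (Fin n) => ‖y - z‖ ^ 2 := by fun_prop
    exact (hcont.measurable.comp (hadapted k)).stronglyMeasurable
  · simp only [hinit]
    exact integrable_const _
  -- The decrease cannot exceed `Z k + e k`, because the integral of the nonnegative `stepBound`
  -- lies below their difference.
  · have h1 := (hone k (x k a)).2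
    have h2 := integral_nonneg (f := stepBound g X (α k) z (x k a)) (hnn k (x k a)) (μ :=
      ν.prod (uniformOn {σ : Fin M → Fin m | Function.Injective σ}))
    linarith
  · calc ∫⁻ a in A, ENNReal.ofReal (‖x (k + 1) a - z‖ ^ 2) ∂P
        ≤ ∫⁻ a in A, ENNReal.ofReal (stepBound g X (α k) z (x k a) (v k a, s k a)) ∂P :=
          lintegral_mono fun a => ENNReal.ofReal_le_ofReal (hstep k a)
      _ = ∫⁻ a in A, ∫⁻ q, ENNReal.ofReal (stepBound g X (α k) z (x k a) q)
            ∂(P.map fun a => (v k a, s k a)) ∂P :=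
          setLIntegral_comp_eq_of_indep (horacle.sampleHistory_le k) (hadapted k)
            (horacle.measurable_samples k) (horacle.indep_sampleHistory k) hA
            (ψ := fun y q => ENNReal.ofReal (stepBound g X (α k) z y q))
            (hb.measurable_stepBound (α k) z).ennreal_ofReal
      _ ≤ _ := by
          refine lintegral_mono fun a => ?_
          rw [horacle.map_samples, ← ofReal_integral_eq_lintegral_ofReal (hone k (x k a)).1
            (ae_of_all _ (hnn k (x k a)))]
          exact ENNReal.ofReal_le_ofReal (hone k (x k a)).2

theorem ae_exists_tendsto_optimalSet_and_tendsto_projDist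
    {Ω V : Type*} [MeasurableSpace Ω] [MeasurableSpace V] {n m M : ℕ}
    {P : Measure Ω} [IsProbabilityMeasure P] {ν : Measure V} [IsProbabilityMeasure ν]
    {f : EuclideanSpace ℝ (Fin n) → V → ℝ}
    {g : EuclideanSpace ℝ (Fin n) → V → EuclideanSpace ℝ (Fin n)}
    {X : Fin m → Set (EuclideanSpace ℝ (Fin n))} (hb : BasicAssumptions ν f g X)
    (hreg : LinearRegularity X) (hM : 0 < M) (hMm : M ≤ m)
    {v : ℕ → Ω → V} {s : ℕ → Ω → Fin M → Fin m} (horacle : IsSamplingOracle P ν v s)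
    {α : ℕ → ℝ} (hα_pos : ∀ k, 0 < α k) (hα : ¬ Summable α)
    (hα_sq : Summable (fun k => α k ^ 2))
    {step : EuclideanSpace ℝ (Fin n) → (Fin M → EuclideanSpace ℝ (Fin n)) →
      EuclideanSpace ℝ (Fin n) → Prop}
    (hstep : ∀ {y p x' z}, step y p x' → (∀ j, inner ℝ (y - p j) (z - p j) ≤ 0) →
      ‖x' - z‖ ^ 2 ≤ ‖y - z‖ ^ 2 - (1 / (M : ℝ)) * ∑ j, ‖y - p j‖ ^ 2)
    {x₀ : EuclideanSpace ℝ (Fin n)} {x : ℕ → Ω → EuclideanSpace ℝ (Fin n)}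
    (hx : IsIterateSequence step g X α x₀ v s x) :
    ∀ᵐ a ∂P, (∃ l ∈ optimalSet (expectedObjective ν f) (feasibleSet X),
        Tendsto (fun k => x k a) atTop (𝓝 l)) ∧
      Tendsto (fun k => projDist (feasibleSet X) (x k a)) atTop (𝓝 0) := by
  obtain ⟨B, hB, hg⟩ := hb.bounded_second_moment
  obtain ⟨c, hc, hcX⟩ := exists_mul_projDist_sq_le_integral_sampledResidual hreg hM hMm
  have key : ∀ z ∈ optimalSet (expectedObjective ν f) (feasibleSet X),
      (∀ᵐ a ∂P, ∃ l, Tendsto (fun k => ‖x k a - z‖ ^ 2) atTop (𝓝 l)) ∧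
      ∀ᵐ a ∂P, Summable fun k => expectedDecrease ν f X c (α k) z (x k a) := fun z hz =>
    ae_tendsto_norm_sub_and_summable_expectedDecrease hb hM hMm hB.le hg hc hcX horacle hα_pos
      hα_sq hx.init hx.adapted hz fun k a => hstep (hx.update k a) fun j =>
        inner_sub_euclProj_nonpos (hb.isClosed_X _) (hb.convex_X _) _ (Set.mem_iInter.1 hz.1 _)
  obtain ⟨z, hz⟩ := hb.exists_optimal
  -- The exceptional null set in `key` depends on `z`; a countable dense set of optimal points
  -- leaves a single null set.
  obtain ⟨S, hSsub, hScount, hSdense⟩ :=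
    (TopologicalSpace.IsSeparable.of_separableSpace
      (optimalSet (expectedObjective ν f) (feasibleSet X))).exists_countable_dense_subset
  filter_upwards [(key z hz).2, (ae_ball_iff hScount).2 fun w hw => (key w (hSsub hw)).1]
    with a hsum hconv
  have hd0 : ∀ k, 0 ≤ c / 4 * projDist (feasibleSet X) (x k a) ^ 2 := fun k => by positivity
  have hgap0 : ∀ k, 0 ≤ α k * (expectedObjective ν f (euclProj (feasibleSet X) (x k a))
      - expectedObjective ν f z) := fun k =>
    mul_nonneg (hα_pos k).le (sub_nonneg.2 (hz.2 _ (isProjection_euclProj hb.nonempty_feasible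
      hb.isClosed_feasibleSet hb.convex_feasibleSet _).1))
  have hgap : Summable fun k => α k * (expectedObjective ν f (euclProj (feasibleSet X) (x k a))
      - expectedObjective ν f z) := Summable.of_nonneg_of_le hgap0 (fun k => by
    have h1 := hd0 k
    have h2 := hgap0 k
    unfold expectedDecrease
    linarith) hsum
  have hdsum : Summable fun k => c / 4 * projDist (feasibleSet X) (x k a) ^ 2 :=
    Summable.of_nonneg_of_le hd0 (fun k => by
      have h2 := hgap0 k
      unfold expectedDecrease
      linarith) hsum
  have hdist : Tendsto (fun k => projDist (feasibleSet X) (x k a)) atTop (𝓝 0) := by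
    have h1 := ((summable_mul_left_iff (by positivity)).1 hdsum).tendsto_atTop_zero.sqrt
    simpa only [Real.sqrt_sq (projDist_nonneg _ _), Real.sqrt_zero] using h1
  refine ⟨exists_tendsto_mem_optimalSet hb.continuous_F hb.nonempty_feasible
    (hb.isCompact_feasibleSet ⟨0, hM.trans_le hMm⟩) hb.convex_feasibleSet hSdense hz hα_pos hα
    (fun w hw => ?_) hgap hdist, hdist⟩
  obtain ⟨l, hl⟩ := hconv w hw
  refine ⟨√l, ?_⟩
  simpa only [Real.sqrt_sq (norm_nonneg _)] using hl.sqrt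

theorem theorem2 {Ω V : Type*} [MeasurableSpace Ω] [MeasurableSpace V] {n m M : ℕ}
    (P : Measure Ω) [IsProbabilityMeasure P] (ν : Measure V) [IsProbabilityMeasure ν]
    (f : EuclideanSpace ℝ (Fin n) → V → ℝ)
    (g : EuclideanSpace ℝ (Fin n) → V → EuclideanSpace ℝ (Fin n))
    (X : Fin m → Set (EuclideanSpace ℝ (Fin n)))
    (hbasic : BasicAssumptions ν f g X)
    (hreg : LinearRegularity X)
    (hM : 0 < M) (hMm : M ≤ m)
    (v : ℕ → Ω → V) (s : ℕ → Ω → Fin M → Fin m)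
    (horacle : IsSamplingOracle P ν v s)
    (α : ℕ → ℝ) (hα_pos : ∀ k, 0 < α k)
    (hα_sum : Tendsto (fun N => ∑ k ∈ Finset.range N, α k) atTop atTop)
    (hα_sq : Summable (fun k => α k ^ 2))
    (x₀ : EuclideanSpace ℝ (Fin n)) (x : ℕ → Ω → EuclideanSpace ℝ (Fin n))
    (hx : IsIterateSequence AveragingStep g X α x₀ v s x ∨
      IsIterateSequence MaxSetStep g X α x₀ v s x ∨
      IsIterateSequence PolyhedralStep g X α x₀ v s x) :
    (∃ xlim : Ω → EuclideanSpace ℝ (Fin n), Measurable xlim ∧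
      ∀ᵐ a ∂P, xlim a ∈ optimalSet (expectedObjective ν f) (feasibleSet X) ∧
        Tendsto (fun k => x k a) atTop (𝓝 (xlim a))) ∧
    ∀ᵐ a ∂P, Tendsto (fun k => projDist (feasibleSet X) (x k a)) atTop (𝓝 0) := by
  have hα : ¬ Summable α := fun h =>
    not_tendsto_nhds_of_tendsto_atTop hα_sum _ h.hasSum.tendsto_sum_nat
  have hmeas : ∀ k, Measurable (x k) := fun k => by
    refine Measurable.mono (ma := sampleHistory v s k) ?_ (horacle.sampleHistory_le k) le_rfl
    rcases hx with hx | hx | hx <;> exact hx.adapted k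
  have hmain : ∀ᵐ a ∂P, (∃ l ∈ optimalSet (expectedObjective ν f) (feasibleSet X),
        Tendsto (fun k => x k a) atTop (𝓝 l)) ∧
      Tendsto (fun k => projDist (feasibleSet X) (x k a)) atTop (𝓝 0) := by
    rcases hx with hx | hx | hx
    · exact ae_exists_tendsto_optimalSet_and_tendsto_projDist hbasic hreg hM hMm horacle hα_pos hα
        hα_sq (AveragingStep.norm_sub_sq_le hM) hx
    · exact ae_exists_tendsto_optimalSet_and_tendsto_projDist hbasic hreg hM hMm horacle hα_pos hα
        hα_sq (MaxSetStep.norm_sub_sq_le hM) hx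
    · exact ae_exists_tendsto_optimalSet_and_tendsto_projDist hbasic hreg hM hMm horacle hα_pos hα
        hα_sq (PolyhedralStep.norm_sub_sq_le hM) hx
  refine ⟨?_, hmain.mono fun a h => h.2⟩
  -- The pathwise limits come without measurability; a measurable version is chosen, and uniqueness
  -- of limits makes it optimal almost surely.
  obtain ⟨xlim, hxlim, hlim⟩ := measurable_limit_of_tendsto_metrizable_ae (L := atTop)
    (fun k => (hmeas k).aemeasurable) (hmain.mono fun a h => h.1.imp fun l hl => hl.2)
  refine ⟨xlim, hxlim, ?_⟩
  filter_upwards [hmain, hlim] with a ⟨⟨l, hl, hxl⟩, _⟩ ha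
  exact ⟨tendsto_nhds_unique hxl ha ▸ hl, ha⟩
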